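/- Let $B_k$ denote the Bernoulli numbers, $\frac{z}{e^z-1}=\sum_{k\ge 0}\frac{B_k}{k!}z^k$. Let $0<p<q$ be relatively prime integers, and let $$\frac qp=a_1+\cfrac{1}{a_2+\cdots+\cfrac{1}{a_n}}$$ be any continued fraction expansion with all $a_i\ge 1$ integers. Put $q_0=1$, and for $1\le i\le n$ let $q_i$ be the numerator in lowest terms of the truncation $a_1+\cfrac{1}{a_2+\cdots+\cfrac{1}{a_i}}$. For a lattice cone $\sigma=\sigma(v_1,v_2)$ generated by linearly independent primitive vectors $v_1,v_2\in\mathbb Z^2$, let $\Gamma_\sigma=\mathbb Z^2/(\mathbb Zv_1+\mathbb Zv_2)$, and for $\gamma\in\Gamma_\sigma$ represented by $g=a_1(g)v_1+a_2(g)v_2$ with $a_1(g),a_2(g)\in\mathbb Q$, let $\chi_{\sigma,i}(\gamma)=e^{2\pi i\,a_i(g)}$ (where the $i$ in the exponent $2\pi i$ is the imaginary unit). The Todd series of $\sigma$ is $$\mathrm{Td}_\sigma(x,y)=\sum_{\gamma\in\Gamma_\sigma}\frac{x}{1-\chi_{\sigma,1}(\gamma)e^{-x}}\cdot\frac{y}{1-\chi_{\sigma,2}(\gamma)e^{-y}}.$$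 Let $\mathrm{Td}_{pq}=\mathrm{Td}_{\sigma((1,0),(p,q))}$, and let $\mathrm{Td}^N_{pq}$ be its homogeneous part of degree $N$. Let $N$ be an even positive integer. Write $B_N=\alpha_N/\beta_N$ in lowest terms with $\beta_N>0$, and let $$r_N=\operatorname{lcm}\Big\{\text{denominator of }\beta_N\tbinom{N}{i+1}B_{i+1}B_{N-i-1}\ \Big|\ i\text{ odd},\ 0\le i\le N-2\Big\}$$ (the least common multiple of the empty set being $1$, so $r_2=1$). Then $$N!\,\beta_N r_N\,\mathrm{Td}^N_{pq}(x,y)-\alpha_N r_N(x+py)^{N-1}x-\alpha_N r_N\big((-1)^{n-1}q_{n-1}x+y\big)^{N-1}y\ \in\ q\,\mathbb Z[x,y].$$ -/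

import Mathlib

noncomputable section

/-! ### Two-dimensional lattice cones in the standard lattice -/

/-- A lattice cone of dimension two: an ordered pair of linearly independent primitive vectors
`v 0`, `v 1` of the standard lattice (the generators of its two rays). -/
structure LatticeCone where
  v : Fin 2 → (Fin 2 → ℤ)
  primitive : ∀ i, IsCoprime (v i 0) (v i 1)
  linearIndependent : LinearIndependent ℤ v

namespace LatticeCone

/-- The integer matrix whose columns are the two generators. -/
def matrix (σ : LatticeCone) : Matrix (Fin 2) (Fin 2) ℤ :=
  Matrix.of fun r c => σ.v c r

/-- The sublattice generated by the two generators. -/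
def sublattice (σ : LatticeCone) : AddSubgroup (Fin 2 → ℤ) :=
  AddSubgroup.closure (Set.range σ.v)

/-- The quotient of the standard lattice by the sublattice of the cone. -/
abbrev Gamma (σ : LatticeCone) : Type := (Fin 2 → ℤ) ⧸ σ.sublattice

theorem det_ne_zero (σ : LatticeCone) : σ.matrix.det ≠ 0 := by
  have h : LinearIndependent ℤ σ.matrix.col := σ.linearIndependent
  intro h0
  obtain ⟨w, hw, hw0⟩ := Matrix.exists_mulVec_eq_zero_iff.mpr h0
  apply hw
  exact (Matrix.mulVec_injective_iff.mpr h) (by simpa using hw0)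

/-- The rational coordinates of a lattice vector with respect to the generators of the cone. -/
def coord (σ : LatticeCone) (g : Fin 2 → ℤ) : Fin 2 → ℚ :=
  (σ.matrix.map (Int.cast : ℤ → ℚ))⁻¹.mulVec fun r => (g r : ℚ)

theorem isUnit_det_map (σ : LatticeCone) : IsUnit (σ.matrix.map (Int.cast : ℤ → ℚ)).det := by
  have h : (σ.matrix.map (Int.cast : ℤ → ℚ)).det = ((σ.matrix.det : ℤ) : ℚ) := by
    simp [Matrix.det_fin_two]
  rw [h, isUnit_iff_ne_zero]
  exact_mod_cast σ.det_ne_zero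

/-- The coordinates are those with `g = a 0 • v 0 + a 1 • v 1`. -/
theorem coord_eq_iff (σ : LatticeCone) (g : Fin 2 → ℤ) (a : Fin 2 → ℚ) :
    σ.coord g = a ↔ ∀ r, (g r : ℚ) = a 0 * σ.v 0 r + a 1 * σ.v 1 r := by
  have key : σ.coord g = a ↔
      (fun r => (g r : ℚ)) = (σ.matrix.map (Int.cast : ℤ → ℚ)).mulVec a := by
    constructor
    · rintro rfl
      rw [coord, Matrix.mulVec_mulVec, Matrix.mul_nonsing_inv _ σ.isUnit_det_map,
        Matrix.one_mulVec]
    · intro h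
      rw [coord, h, Matrix.mulVec_mulVec, Matrix.nonsing_inv_mul _ σ.isUnit_det_map,
        Matrix.one_mulVec]
  rw [key, funext_iff]
  simp [Matrix.mulVec, dotProduct, matrix, mul_comm]

theorem coord_add (σ : LatticeCone) (g h : Fin 2 → ℤ) :
    σ.coord (g + h) = σ.coord g + σ.coord h := by
  rw [coord, coord, coord, ← Matrix.mulVec_add]
  congr 1
  ext r
  simp

theorem coord_zero (σ : LatticeCone) : σ.coord 0 = 0 := by
  rw [coord_eq_iff]
  simp

theorem coord_generator (σ : LatticeCone) (i : Fin 2) : σ.coord (σ.v i) = Pi.single i 1 := by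
  rw [coord_eq_iff]
  intro r
  fin_cases i <;> simp

/-- The complex number `exp (2 π i a)` for the `i`-th coordinate `a` of a lattice vector. -/
def latticeChar (σ : LatticeCone) (i : Fin 2) (g : Fin 2 → ℤ) : ℂ :=
  Complex.exp (2 * Real.pi * Complex.I * ((σ.coord g i : ℚ) : ℂ))

theorem latticeChar_add (σ : LatticeCone) (i : Fin 2) (g h : Fin 2 → ℤ) :
    σ.latticeChar i (g + h) = σ.latticeChar i g * σ.latticeChar i h := by
  rw [latticeChar, latticeChar, latticeChar, ← Complex.exp_add, coord_add]
  congr 1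
  push_cast [Pi.add_apply]
  ring

theorem latticeChar_of_mem (σ : LatticeCone) (i : Fin 2) (g : Fin 2 → ℤ)
    (hg : g ∈ σ.sublattice) : σ.latticeChar i g = 1 := by
  induction hg using AddSubgroup.closure_induction with
  | mem x hx =>
    obtain ⟨j, rfl⟩ := hx
    rw [latticeChar, coord_generator]
    by_cases hij : i = j
    · subst hij; simp [Complex.exp_two_pi_mul_I]
    · simp [hij]
  | zero => simp [latticeChar, coord_zero]
  | add x y _ _ hx hy => rw [latticeChar_add, hx, hy, one_mul]
  | neg x _ hx =>
    have h := σ.latticeChar_add i x (-x)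
    rw [hx, one_mul, add_neg_cancel] at h
    rw [← h]
    simp [latticeChar, coord_zero]

/-- The `i`-th character of the finite group `σ.Gamma`. -/
def char (σ : LatticeCone) (i : Fin 2) (γ : σ.Gamma) : ℂ :=
  Quotient.liftOn' γ (σ.latticeChar i) fun g h hgh => by
    have hm := σ.latticeChar_of_mem i _ (QuotientAddGroup.leftRel_apply.mp hgh)
    have h2 := σ.latticeChar_add i g (-g + h)
    rw [hm, mul_one, add_neg_cancel_left] at h2
    exact h2.symm

theorem char_mk (σ : LatticeCone) (i : Fin 2) (g : Fin 2 → ℤ) :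
    σ.char i (QuotientAddGroup.mk g) = σ.latticeChar i g := rfl

theorem det_smul_mem (σ : LatticeCone) (g : Fin 2 → ℤ) :
    σ.matrix.det • g ∈ σ.sublattice := by
  have h : σ.matrix.det • g =
      (σ.matrix.adjugate.mulVec g 0) • σ.v 0 + (σ.matrix.adjugate.mulVec g 1) • σ.v 1 := by
    ext r
    fin_cases r <;>
      simp [Matrix.det_fin_two, Matrix.adjugate_fin_two, Matrix.mulVec, dotProduct, matrix] <;>
      ring
  rw [h]
  exact add_mem (zsmul_mem (AddSubgroup.subset_closure (Set.mem_range_self 0)) _)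
    (zsmul_mem (AddSubgroup.subset_closure (Set.mem_range_self 1)) _)

instance finite_quot (σ : LatticeCone) : Finite σ.Gamma := by
  have : AddGroup.FG σ.Gamma := QuotientAddGroup.fg _
  apply AddCommGroup.finite_of_fg_isAddTorsion
  intro γ
  obtain ⟨g, rfl⟩ := QuotientAddGroup.mk_surjective γ
  rw [isOfFinAddOrder_iff_zsmul_eq_zero]
  refine ⟨σ.matrix.det, σ.det_ne_zero, ?_⟩
  rw [← QuotientAddGroup.mk_zsmul, QuotientAddGroup.eq_zero_iff]
  exact σ.det_smul_mem g

instance fintype_quot (σ : LatticeCone) : Fintype σ.Gamma := Fintype.ofFinite _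

end LatticeCone

/-! ### Todd series -/

/-- The power series `1 - c * exp (-z)`. -/
def toddDenom (c : ℂ) : PowerSeries ℂ :=
  1 - PowerSeries.C c * PowerSeries.evalNegHom (PowerSeries.exp ℂ)

/-- The power series `z / (1 - c * exp (-z))`. For `c = 1` the denominator is `z` times an
invertible series, whose coefficients are those of the denominator shifted by one. -/
def toddFactor (c : ℂ) : PowerSeries ℂ :=
  if c = 1 then (PowerSeries.mk fun n => PowerSeries.coeff (n + 1) (toddDenom 1))⁻¹
  else PowerSeries.X * (toddDenom c)⁻¹

/-- `toddFactor c` is indeed the quotient of `z` by `1 - c * exp (-z)`. -/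
theorem toddFactor_mul_toddDenom (c : ℂ) : toddFactor c * toddDenom c = PowerSeries.X := by
  have h0 : ∀ c : ℂ, PowerSeries.constantCoeff (toddDenom c) = 1 - c := by
    intro c
    rw [← PowerSeries.coeff_zero_eq_constantCoeff_apply]
    simp [toddDenom, PowerSeries.evalNegHom, PowerSeries.coeff_rescale,
      -PowerSeries.coeff_zero_eq_constantCoeff]
  unfold toddFactor
  split_ifs with hc
  · subst hc
    set u : PowerSeries ℂ := PowerSeries.mk fun n => PowerSeries.coeff (n + 1) (toddDenom 1)
      with hu
    have hX : toddDenom 1 = u * PowerSeries.X := by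
      have h := PowerSeries.eq_shift_mul_X_add_const (toddDenom 1)
      rw [h0 1, sub_self, map_zero, add_zero] at h
      exact h
    have hu0 : PowerSeries.constantCoeff u ≠ 0 := by
      rw [← PowerSeries.coeff_zero_eq_constantCoeff_apply, hu, PowerSeries.coeff_mk]
      simp [toddDenom, PowerSeries.evalNegHom, PowerSeries.coeff_one, PowerSeries.coeff_exp,
        PowerSeries.coeff_rescale, -PowerSeries.coeff_zero_eq_constantCoeff]
    rw [hX, ← mul_assoc, PowerSeries.inv_mul_cancel u hu0, one_mul]
  · have hd : PowerSeries.constantCoeff (toddDenom c) ≠ 0 := by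
      rw [h0 c]; exact sub_ne_zero.mpr (Ne.symm hc)
    rw [mul_assoc, PowerSeries.inv_mul_cancel _ hd, mul_one]

/-- The Todd series of a lattice cone, a formal power series in two variables. -/
def LatticeCone.todd (σ : LatticeCone) : MvPowerSeries (Fin 2) ℂ :=
  ∑ γ : σ.Gamma,
    (toddFactor (σ.char 0 γ)).subst (MvPowerSeries.X (0 : Fin 2) : MvPowerSeries (Fin 2) ℂ) *
    (toddFactor (σ.char 1 γ)).subst (MvPowerSeries.X (1 : Fin 2) : MvPowerSeries (Fin 2) ℂ)

/-- The cone generated by `(1, 0)` and `(p, q)`. -/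
def standardCone (p q : ℕ) (hq : 0 < q) (hpq : Nat.Coprime p q) : LatticeCone where
  v := ![![1, 0], ![(p : ℤ), (q : ℤ)]]
  primitive i := by
    fin_cases i
    · exact isCoprime_one_left
    · simpa using Nat.isCoprime_iff_coprime.mpr hpq
  linearIndependent := by
    rw [LinearIndependent.pair_iff]
    intro s t h
    have h0 := congrFun h 0
    have h1 := congrFun h 1
    simp [hq.ne'] at h0 h1
    subst h1
    simp at h0
    exact ⟨h0, rfl⟩

/-! ### Finite continued fractions -/

/-- The value `a₁ + 1 / (a₂ + 1 / (⋯ + 1 / aₙ))`. -/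
def cfValue : List ℕ → ℚ
  | [] => 0
  | [a] => a
  | a :: b :: l => a + 1 / cfValue (b :: l)

/-- The numerator `qᵢ` of the truncation `a₁ + 1 / (a₂ + ⋯ + 1 / aᵢ)` in lowest terms, with the
convention `q₀ = 1`. -/
def cfNum (a : List ℕ) (i : ℕ) : ℤ :=
  if i = 0 then 1 else (cfValue (a.take i)).num

/-! ### The Bernoulli constants -/

/-- The numerator of the `N`-th Bernoulli number. -/
def bernoulliNum (N : ℕ) : ℤ := (bernoulli N).num

/-- The denominator of the `N`-th Bernoulli number. -/
def bernoulliDen (N : ℕ) : ℕ := (bernoulli N).den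

/-- The least common multiple of the denominators of
`β_N * binom N (i + 1) * B_{i+1} * B_{N-i-1}` over the odd `i` with `0 ≤ i ≤ N - 2`. -/
def toddLcm (N : ℕ) : ℕ :=
  ((Finset.range (N - 1)).filter fun i => Odd i).lcm fun i =>
    ((bernoulliDen N : ℚ) * (N.choose (i + 1) : ℚ) *
      bernoulli (i + 1) * bernoulli (N - i - 1)).den

end

/-!
Linear forms in `x`, `y` with `k x + l y`, `l ≡ p k` modulo `q`, form a lattice with basis
`w = x + p y`, `v = q y`, and `Td_{pq}` is, up to the factor `q x y`, the generating series
`∑ exp (-m)` over the lattice points `m` of the cone spanned by `q x` and `q y`. This is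
orthogonality of the characters of a cyclic group (`coneTodd_eq_gradedTodd`).

Generating series of lattice points are additive under subdivision. Cutting the cone spanned by
`v₁ = q w - p v` and `v` along the ray through `w`, for `0 < p < q`, produces the unimodular cone
spanned by `w`, `v` and a cone of the smaller multiplicity `p` (`coneTodd_reciprocity`, which rests
on counting the points under a staircase in two ways). Hence, by induction on `q`, the Todd series
divided by the product of its generators is a sum of series `1 / ((1 - exp (-u)) (1 - exp (-u')))`
over unimodular cones, corrected by `1 / (1 - exp (-u))` for the interior rays.

In degree `N`, after multiplication by `N! β_N r_N`, the mixed terms of each unimodular cone are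
integral forms, by definition of `r_N`. The pure powers contribute multiples of
`(u' ^ (N - 1) + u'' ^ (N - 1)) / u` at an interior ray `u` with neighbours `u'`, `u''`. As
`u' + u''` is a multiple of `u` and `N - 1` is odd, these are integral as well. Only the pure powers
at the two outer rays survive (`ClearsBernoulli.coeff_coneTodd`); they give `(x + p y) ^ (N - 1) x`
and `(s x + y) ^ (N - 1) y`, where `s` is any inverse of `p` modulo `q`. By the determinant identity
for convergents, `s = (-1) ^ (n - 1) q_{n-1}` is such an inverse
(`exists_mul_add_mul_cfNum_eq_one`).

Denominators are avoided throughout by working in power series in an auxiliary variable `T` that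
records the degree, over a domain containing the linear forms.
-/

noncomputable section
open PowerSeries Finset

/-! ### Staircase sums -/

/-- Both sides come from summing `(1 - a) (1 - c) a ^ i c ^ j` over the lattice points with
`i < q` and `(j + 1) q ≤ i p`, once by columns and once by rows. -/
theorem staircase_sum_eq {R : Type*} [CommRing R] (a c : R) {p q : ℕ} (hp : 0 < p) (hq : 0 < q) :
    (1 - a ^ q) - (1 - a) * ∑ i ∈ range q, a ^ i * c ^ (i * p / q) =
      (1 - c) * (∑ j ∈ range p, c ^ j * a ^ ((j + 1) * q ⌈/⌉ p)) - (1 - c ^ p) * a ^ q := by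
  have hswap : ∑ i ∈ range q, ∑ j ∈ range (i * p / q), (1 - a) * a ^ i * ((1 - c) * c ^ j) =
      ∑ j ∈ range p, ∑ i ∈ Ico ((j + 1) * q ⌈/⌉ p) q, (1 - a) * a ^ i * ((1 - c) * c ^ j) := by
    apply Finset.sum_comm'
    intro i j
    have h1 : j < i * p / q ↔ (j + 1) * q ≤ i * p := by
      rw [← Nat.le_div_iff_mul_le hq, Nat.succ_le_iff]
    have h2 : (j + 1) * q ⌈/⌉ p ≤ i ↔ (j + 1) * q ≤ i * p := by
      rw [ceilDiv_le_iff_le_mul hp, mul_comm p]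
    simp only [mem_range, mem_Ico, h1, h2]
    refine ⟨fun h => ⟨⟨h.2, h.1⟩, ?_⟩, fun h => ⟨h.1.2, h.1.1⟩⟩
    by_contra hj
    have h3 : i * p < q * p := Nat.mul_lt_mul_of_pos_right h.1 hp
    have h4 : (p + 1) * q ≤ (j + 1) * q := Nat.mul_le_mul_right q (by omega)
    nlinarith [h.2]
  have hg : ∀ (x : R) (n : ℕ), ∑ i ∈ range n, (1 - x) * x ^ i = 1 - x ^ n := fun x n => by
    rw [← mul_sum, mul_neg_geom_sum]
  have hl : ∑ i ∈ range q, ∑ j ∈ range (i * p / q), (1 - a) * a ^ i * ((1 - c) * c ^ j) =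
      (1 - a ^ q) - (1 - a) * ∑ i ∈ range q, a ^ i * c ^ (i * p / q) := by
    rw [mul_sum, ← hg a q, ← sum_sub_distrib]
    refine sum_congr rfl fun i _ => ?_
    rw [← mul_sum, hg]
    ring
  have hr : ∑ j ∈ range p, ∑ i ∈ Ico ((j + 1) * q ⌈/⌉ p) q,
        (1 - a) * a ^ i * ((1 - c) * c ^ j) =
      (1 - c) * (∑ j ∈ range p, c ^ j * a ^ ((j + 1) * q ⌈/⌉ p)) - (1 - c ^ p) * a ^ q := by
    rw [mul_sum, ← hg c p, sum_mul, ← sum_sub_distrib]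
    refine sum_congr rfl fun j hj => ?_
    have hle : (j + 1) * q ⌈/⌉ p ≤ q := by
      rw [ceilDiv_le_iff_le_mul hp]
      exact Nat.mul_le_mul_right q (by simpa using hj)
    have h5 : ∑ i ∈ Ico ((j + 1) * q ⌈/⌉ p) q, (1 - a) * a ^ i =
        a ^ ((j + 1) * q ⌈/⌉ p) - a ^ q := by
      rw [sum_Ico_eq_sub _ hle, hg, hg]
      ring
    rw [← sum_mul, h5]
    ring
  rw [← hl, hswap, hr]

/-- The additivity of lattice point generating functions for the subdivision of a cone into a
unimodular cone and a cone of smaller multiplicity, with the denominators cleared. -/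
theorem staircase_reciprocity {R : Type*} [CommRing R] (a c : R) {p q : ℕ} (hp : 0 < p)
    (hq : 0 < q) :
    c * ((1 - a) * ∑ i ∈ range q, a ^ i * c ^ (i * p / q)) =
      (c - 1) * (∑ j ∈ range p, c ^ j * a ^ (j * q ⌈/⌉ p)) + (1 - a ^ q * c ^ p) := by
  have h := staircase_sum_eq a c hp hq
  have hshift : c * ∑ j ∈ range p, c ^ j * a ^ ((j + 1) * q ⌈/⌉ p) =
      (∑ j ∈ range p, c ^ j * a ^ (j * q ⌈/⌉ p)) + c ^ p * a ^ q - 1 := by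
    have h1 := sum_range_succ (fun j => c ^ j * a ^ (j * q ⌈/⌉ p)) p
    have h2 := sum_range_succ' (fun j => c ^ j * a ^ (j * q ⌈/⌉ p)) p
    have h3 : p * q ⌈/⌉ p = q := by
      simpa [smul_eq_mul] using smul_ceilDiv (b := q) hp
    have h4 : 0 * q ⌈/⌉ p = 0 := by simp
    rw [h3] at h1
    rw [h4] at h2
    rw [mul_sum]
    have h5 : ∑ j ∈ range p, c * (c ^ j * a ^ ((j + 1) * q ⌈/⌉ p)) =
        ∑ j ∈ range p, c ^ (j + 1) * a ^ ((j + 1) * q ⌈/⌉ p) :=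
      sum_congr rfl fun j _ => by ring
    rw [h5]
    simp only [pow_zero, mul_one] at h2
    linear_combination h1 - h2
  linear_combination (-c) * h - (1 - c) * hshift

theorem mul_neg_ediv_eq_neg_ceilDiv (j q : ℕ) {p : ℕ} (hp : 0 < p) :
    ((j : ℤ) * (-(q : ℤ))) / (p : ℤ) = -((j * q ⌈/⌉ p : ℕ) : ℤ) := by
  have hp' : (0 : ℤ) < p := by exact_mod_cast hp
  have key : ∀ n : ℕ, j * q ⌈/⌉ p ≤ n ↔ j * q ≤ p * n := fun n => by
    rw [ceilDiv_le_iff_le_mul hp]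
  apply le_antisymm
  · by_contra! hlt
    obtain ⟨n, hn⟩ : ∃ n : ℕ, (n : ℤ) = -(((j : ℤ) * (-(q : ℤ))) / (p : ℤ)) := by
      refine ⟨(-(((j : ℤ) * (-(q : ℤ))) / (p : ℤ))).toNat, Int.toNat_of_nonneg ?_⟩
      have : ((j : ℤ) * (-(q : ℤ))) / (p : ℤ) ≤ 0 :=
        Int.ediv_nonpos_of_nonpos_of_neg (by nlinarith [Int.natCast_nonneg j, Int.natCast_nonneg q])
          hp'
      omega
    have h1 : j * q ⌈/⌉ p ≤ n := by
      rw [key]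
      have h2 := Int.ediv_mul_le ((j : ℤ) * (-(q : ℤ))) hp'.ne'
      have : (j : ℤ) * q ≤ p * n := by rw [hn]; linarith
      exact_mod_cast this
    omega
  · rw [Int.le_ediv_iff_mul_le hp']
    have h1 : (j * q : ℤ) ≤ p * ((j * q ⌈/⌉ p : ℕ) : ℤ) := by exact_mod_cast (key _).1 le_rfl
    linarith

/-! ### Exponential and Todd series of linear forms -/

section Series

variable {A : Type*} [CommRing A] [Algebra ℚ A]

/-- The power series `exp (-v T)` in the variable `T`, for an element `v` of the coefficient
ring. The variable `T` records the degree of homogeneous elements. -/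
def expNeg (v : A) : A⟦X⟧ := rescale (-v) (PowerSeries.exp A)

/-- The power series `v T / (1 - exp (-v T))`. -/
def toddOf (v : A) : A⟦X⟧ := rescale v (bernoulli'PowerSeries A)

theorem expNeg_add (u v : A) : expNeg (u + v) = expNeg u * expNeg v := by
  rw [expNeg, expNeg, expNeg, exp_mul_exp_eq_exp_add, neg_add]

theorem expNeg_zero : expNeg (0 : A) = 1 := by
  simp [expNeg]

theorem expNeg_natCast_mul (n : ℕ) (v : A) : expNeg ((n : A) * v) = expNeg v ^ n := by
  induction n with
  | zero => simp [expNeg_zero]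
  | succ n ih => rw [Nat.cast_succ, add_mul, one_mul, expNeg_add, ih, pow_succ]

theorem expNeg_mul_expNeg_neg (v : A) : expNeg v * expNeg (-v) = 1 := by
  rw [← expNeg_add, add_neg_cancel, expNeg_zero]

theorem toddOf_mul_one_sub_expNeg (v : A) : toddOf v * (1 - expNeg v) = C v * X := by
  have h := congrArg (rescale v) (bernoulli'PowerSeries_mul_exp_sub_one A)
  rw [map_mul, map_mul, map_sub, map_one, rescale_X] at h
  have h2 : rescale v (PowerSeries.exp A) = expNeg (-v) := by rw [expNeg, neg_neg]
  rw [h2] at h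
  change toddOf v * _ = _ at h
  linear_combination (expNeg v) * h + (C v * X - toddOf v) * expNeg_mul_expNeg_neg v

theorem coeff_toddOf (v : A) (n : ℕ) :
    coeff n (toddOf v) = v ^ n * algebraMap ℚ A (bernoulli' n / n.factorial) := by
  rw [toddOf, coeff_rescale, bernoulli'PowerSeries, coeff_mk]

/-- The generating series of the lattice points of the half-open parallelogram spanned by
`q w - p v` and `v`, for the lattice with basis `w`, `v`. -/
def parallelogramSum (q : ℕ) (p : ℤ) (w v : A) : A⟦X⟧ :=
  ∑ i ∈ range q, expNeg ((i : A) * w - (((i * p) / q : ℤ) : A) * v)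

/-- The Todd series of the cone spanned by `q w - p v` and `v`, in the lattice with basis
`w`, `v`. -/
def coneTodd (q : ℕ) (p : ℤ) (w v : A) : A⟦X⟧ :=
  toddOf ((q : A) * w - (p : A) * v) * toddOf v * parallelogramSum q p w v

theorem parallelogramSum_reciprocity {p q : ℕ} (hp : 0 < p) (hq : 0 < q) (w v : A) :
    (1 - expNeg w) * parallelogramSum q p w v =
      (1 - expNeg v) * parallelogramSum p (-(q : ℤ)) (-v) w +
        (1 - expNeg ((q : A) * w - (p : A) * v)) * expNeg v := by
  have h1 : parallelogramSum q (p : ℤ) w v =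
      ∑ i ∈ range q, expNeg w ^ i * expNeg (-v) ^ (i * p / q) := by
    refine sum_congr rfl fun i _ => ?_
    rw [← expNeg_natCast_mul, ← expNeg_natCast_mul, ← expNeg_add]
    congr 1
    norm_cast
    ring
  have h2 : parallelogramSum p (-(q : ℤ)) (-v) w =
      ∑ j ∈ range p, expNeg (-v) ^ j * expNeg w ^ (j * q ⌈/⌉ p) := by
    refine sum_congr rfl fun j _ => ?_
    rw [← expNeg_natCast_mul, ← expNeg_natCast_mul, ← expNeg_add,
      mul_neg_ediv_eq_neg_ceilDiv j q hp]
    congr 1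
    push_cast
    ring
  have h3 : expNeg ((q : A) * w - (p : A) * v) = expNeg w ^ q * expNeg (-v) ^ p := by
    rw [← expNeg_natCast_mul, ← expNeg_natCast_mul, ← expNeg_add]
    congr 1
    ring
  have h := staircase_reciprocity (expNeg w) (expNeg (-v)) hp hq
  have h0 := expNeg_mul_expNeg_neg v
  rw [h1, h2, h3]
  linear_combination (expNeg v) * h + ((∑ j ∈ range p, expNeg (-v) ^ j * expNeg w ^ (j * q ⌈/⌉ p))
    - (1 - expNeg w) * ∑ i ∈ range q, expNeg w ^ i * expNeg (-v) ^ (i * p / q)) * h0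

/-- Additivity of Todd series under the subdivision of the cone spanned by `q w - p v` and `v`
along the ray through `w`, multiplied by `w`. -/
theorem coneTodd_reciprocity [IsDomain A] {p q : ℕ} (hp : 0 < p) (hq : 0 < q) (w v : A) :
    C w * coneTodd q p w v = C v * coneTodd p (-(q : ℤ)) (-v) w +
      C ((q : A) * w - (p : A) * v) * ((toddOf v - C v * X) * toddOf w) := by
  have h := parallelogramSum_reciprocity hp hq w v
  have hw := toddOf_mul_one_sub_expNeg w
  have hv := toddOf_mul_one_sub_expNeg v
  have h1 := toddOf_mul_one_sub_expNeg ((q : A) * w - (p : A) * v)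
  have hc : ((p : ℕ) : A) * (-v) - ((-(q : ℤ) : ℤ) : A) * w = (q : A) * w - (p : A) * v := by
    push_cast
    ring
  apply mul_left_cancel₀ (PowerSeries.X_ne_zero (R := A))
  unfold coneTodd
  rw [hc, Int.cast_natCast]
  set H1 := toddOf ((q : A) * w - (p : A) * v)
  set E1 := expNeg ((q : A) * w - (p : A) * v)
  linear_combination (H1 * toddOf v * toddOf w) * h
    - (H1 * toddOf v * parallelogramSum q (p : ℤ) w v) * hw
    + (H1 * toddOf w * parallelogramSum p (-(q : ℤ)) (-v) w) * hv
    + (toddOf w * (toddOf v - C v * X)) * h1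
    - (toddOf w * H1 * (1 - E1)) * hv

theorem parallelogramSum_shift {q : ℕ} (hq : 0 < q) (p k : ℤ) (w v : A) :
    parallelogramSum q (p + q * k) w v = parallelogramSum q p (w - (k : A) * v) v := by
  refine sum_congr rfl fun i _ => ?_
  have hq' : (q : ℤ) ≠ 0 := by exact_mod_cast hq.ne'
  have h : ((i : ℤ) * (p + q * k)) / q = (i * p) / q + i * k := by
    rw [← Int.add_mul_ediv_left _ _ hq']
    congr 1
    ring
  rw [h]
  congr 1
  push_cast
  ring

theorem coneTodd_shift {q : ℕ} (hq : 0 < q) (p k : ℤ) (w v : A) :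
    coneTodd q (p + q * k) w v = coneTodd q p (w - (k : A) * v) v := by
  have h : (q : A) * w - ((p + q * k : ℤ) : A) * v = (q : A) * (w - (k : A) * v) - (p : A) * v := by
    push_cast
    ring
  rw [coneTodd, coneTodd, parallelogramSum_shift hq, h]

theorem coneTodd_one (p : ℤ) (w v : A) :
    coneTodd 1 p w v = toddOf (w - (p : A) * v) * toddOf v := by
  simp [coneTodd, parallelogramSum, expNeg_zero]

end Series

/-! ### Integrality of products of Bernoulli numbers -/

theorem bernoulli'_eq_bernoulli_of_even {n : ℕ} (hn : Even n) : bernoulli' n = bernoulli n := by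
  rw [bernoulli'_eq_bernoulli, hn.neg_one_pow, one_mul]

theorem factorial_mul_bernoulli'_div_factorial {N : ℕ} (hN : Even N) :
    ((N.factorial : ℚ) * bernoulliDen N * toddLcm N) * (bernoulli' N / N.factorial) =
      ((bernoulliNum N * toddLcm N : ℤ) : ℚ) := by
  have hf : (N.factorial : ℚ) ≠ 0 := by exact_mod_cast N.factorial_ne_zero
  have h := Rat.mul_den_eq_num (bernoulli N)
  rw [bernoulli'_eq_bernoulli_of_even hN]
  unfold bernoulliDen bernoulliNum
  push_cast
  rw [← h]
  field_simp

theorem exists_int_eq_mul_of_den_dvd {x : ℚ} {r : ℕ} (h : x.den ∣ r) : ∃ z : ℤ, r * x = z := by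
  obtain ⟨m, rfl⟩ := h
  refine ⟨m * x.num, ?_⟩
  have := Rat.mul_den_eq_num x
  push_cast
  rw [← this]
  ring

theorem bernoulliDen_two : bernoulliDen 2 = 6 := by
  norm_num [bernoulliDen]

theorem exists_int_eq_mul_bernoulli'_mul_bernoulli' {N : ℕ} (hN : Even N) {k l : ℕ} (hk : 0 < k)
    (hl : 0 < l) (hkl : k + l = N) :
    ∃ z : ℤ, ((N.factorial : ℚ) * bernoulliDen N * toddLcm N) *
      (bernoulli' k / k.factorial * (bernoulli' l / l.factorial)) = z := by
  rcases Nat.even_or_odd k with hke | hko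
  · have hle : Even l := by
      rw [← hkl] at hN
      exact (Nat.even_add.1 hN).1 hke
    have hdvd : ((bernoulliDen N : ℚ) * (N.choose (k - 1 + 1) : ℚ) *
        bernoulli (k - 1 + 1) * bernoulli (N - (k - 1) - 1)).den ∣ toddLcm N := by
      unfold toddLcm
      apply Finset.dvd_lcm (f := fun i => ((bernoulliDen N : ℚ) * (N.choose (i + 1) : ℚ) *
        bernoulli (i + 1) * bernoulli (N - i - 1)).den)
      rw [mem_filter, mem_range]
      refine ⟨by omega, ?_⟩
      rw [← Nat.not_even_iff_odd]
      intro h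
      have := h.add_one
      rw [show k - 1 + 1 = k by omega] at this
      exact (Nat.not_even_iff_odd.2 this) hke
    obtain ⟨z, hz⟩ := exists_int_eq_mul_of_den_dvd hdvd
    refine ⟨z, ?_⟩
    rw [← hz, Nat.sub_add_cancel hk, show N - (k - 1) - 1 = l by omega,
      bernoulli'_eq_bernoulli_of_even hke, bernoulli'_eq_bernoulli_of_even hle, ← hkl,
      ← Nat.add_choose_mul_factorial_mul_factorial k l, Nat.choose_symm_add]
    have h1 : (k.factorial : ℚ) ≠ 0 := by exact_mod_cast k.factorial_ne_zero
    have h2 : (l.factorial : ℚ) ≠ 0 := by exact_mod_cast l.factorial_ne_zero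
    push_cast
    field_simp
  · have hlo : Odd l := by
      rw [← hkl] at hN
      rw [← Nat.not_even_iff_odd] at hko ⊢
      exact fun h => hko ((Nat.even_add.1 hN).2 h)
    by_cases hk1 : k = 1
    · by_cases hl1 : l = 1
      · subst hk1 hl1
        subst hkl
        refine ⟨3 * toddLcm 2, ?_⟩
        rw [show 1 + 1 = 2 from rfl, bernoulliDen_two, bernoulli'_one]
        norm_num [Nat.factorial]
        ring
      · exact ⟨0, by simp [bernoulli'_eq_zero_of_odd hlo (by omega)]⟩
    · exact ⟨0, by simp [bernoulli'_eq_zero_of_odd hko (by omega)]⟩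

theorem exists_int_eq_mul_bernoulli'_pred {N : ℕ} (hN : Even N) (hN0 : 0 < N) :
    ∃ z : ℤ, ((N.factorial : ℚ) * bernoulliDen N * toddLcm N) *
      (bernoulli' (N - 1) / (N - 1).factorial) = z := by
  obtain ⟨m, rfl⟩ := hN
  by_cases hm : m = 1
  · subst hm
    refine ⟨6 * toddLcm 2, ?_⟩
    rw [show 1 + 1 = 2 from rfl, bernoulliDen_two, show 2 - 1 = 1 from rfl, bernoulli'_one]
    norm_num [Nat.factorial]
    ring
  · exact ⟨0, by simp [bernoulli'_eq_zero_of_odd (n := m + m - 1) ⟨m - 1, by omega⟩ (by omega)]⟩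

/-! ### Todd series of plane cones modulo integral forms -/

section Integrality

variable {A : Type*} [CommRing A] [Algebra ℚ A]

/-- Multiplication by `K` makes the Todd series of a unimodular cone integral in degree `N`, the
pure powers receiving the coefficient `κ`. It also clears the denominator of the coefficient of
degree `N - 1` of `z / (1 - exp (-z))`. The numbers `bernoulli'` are used because they are the
coefficients of that series. -/
structure ClearsBernoulli (N : ℕ) (K : ℚ) (κ : ℤ) : Prop where
  top : K * (bernoulli' N / N.factorial) = κ
  mixed : ∀ k l : ℕ, 0 < k → 0 < l → k + l = N →
    ∃ z : ℤ, K * (bernoulli' k / k.factorial * (bernoulli' l / l.factorial)) = z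
  pred : ∃ z : ℤ, K * (bernoulli' (N - 1) / (N - 1).factorial) = z

theorem clearsBernoulli {N : ℕ} (hN : Even N) (hN0 : 0 < N) :
    ClearsBernoulli N ((N.factorial : ℚ) * bernoulliDen N * toddLcm N)
      (bernoulliNum N * toddLcm N) where
  top := factorial_mul_bernoulli'_div_factorial hN
  mixed _ _ hk hl hkl := exists_int_eq_mul_bernoulli'_mul_bernoulli' hN hk hl hkl
  pred := exists_int_eq_mul_bernoulli'_pred hN hN0

theorem ClearsBernoulli.coeff_toddOf_mul_toddOf {N : ℕ} {K : ℚ} {κ : ℤ}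
    (h : ClearsBernoulli N K κ) (hN0 : 0 < N) (S : Subring A) {u v : A} (hu : u ∈ S)
    (hv : v ∈ S) :
    ∃ Q ∈ S, algebraMap ℚ A K * coeff N (toddOf u * toddOf v) =
      κ * u ^ N + κ * v ^ N + u * v * Q := by
  obtain ⟨M, rfl⟩ : ∃ M, N = M + 1 := ⟨N - 1, by omega⟩
  have hz : ∀ i : ℕ, ∃ z : ℤ, i < M → K * (bernoulli' (i + 1) / (i + 1).factorial *
      (bernoulli' (M - 1 - i + 1) / (M - 1 - i + 1).factorial)) = z := by
    intro i
    by_cases hi : i < M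
    · obtain ⟨z, hz⟩ := h.mixed (i + 1) (M - 1 - i + 1) (by omega) (by omega) (by omega)
      exact ⟨z, fun _ => hz⟩
    · exact ⟨0, fun h => absurd h hi⟩
  choose z hz using hz
  refine ⟨∑ i ∈ range M, (z i : A) * u ^ i * v ^ (M - 1 - i),
    sum_mem fun i _ => mul_mem (mul_mem (intCast_mem S _) (pow_mem hu _)) (pow_mem hv _), ?_⟩
  have htop : algebraMap ℚ A K * algebraMap ℚ A (bernoulli' (M + 1) / (M + 1).factorial) =
      (κ : A) := by
    rw [← map_mul, h.top, map_intCast]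
  have hzero : algebraMap ℚ A (bernoulli' 0 / (Nat.factorial 0 : ℕ)) = 1 := by
    simp [bernoulli'_zero]
  have hmid : ∀ i ∈ range M, algebraMap ℚ A K * (coeff (i + 1) (toddOf u) *
      coeff (M + 1 - (i + 1)) (toddOf v)) = u * v * ((z i : A) * u ^ i * v ^ (M - 1 - i)) := by
    intro i hi
    rw [mem_range] at hi
    rw [show M + 1 - (i + 1) = M - 1 - i + 1 by omega, coeff_toddOf, coeff_toddOf,
      ← map_intCast (algebraMap ℚ A) (z i), ← hz i hi, map_mul, map_mul]
    ring
  rw [coeff_mul, Finset.Nat.sum_antidiagonal_eq_sum_range_succ_mk, sum_range_succ,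
    sum_range_succ']
  simp only [mul_add]
  rw [mul_sum, sum_congr rfl hmid, ← mul_sum]
  simp only [Nat.sub_self, Nat.sub_zero, coeff_toddOf, hzero, pow_zero, one_mul, mul_one]
  linear_combination (u ^ (M + 1) + v ^ (M + 1)) * htop

/-- In a subring, `a - b` divides `a ^ n - b ^ n` with a cofactor in that subring. -/
theorem Subring.exists_pow_sub_pow_eq {R : Type*} [CommRing R] (S : Subring R) {a b : R}
    (ha : a ∈ S) (hb : b ∈ S) (n : ℕ) : ∃ P ∈ S, a ^ n - b ^ n = (a - b) * P := by
  obtain ⟨P, hP⟩ := sub_dvd_pow_sub_pow (⟨a, ha⟩ : S) ⟨b, hb⟩ n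
  exact ⟨P, P.2, congrArg Subtype.val hP⟩

/-- The degree `N` part of the Todd series of a plane cone, modulo the product of the two
generators `q w - p v`, `v` with integral forms. The induction on the multiplicity `q` follows the
subdivision into unimodular cones: each mixed Bernoulli term is integral, and the pure powers
attached to interior rays cancel, leaving those at the two outer rays. The vectors
`w` and `s w + t v` complete `v` and `q w - p v` respectively to a basis of the lattice. -/
theorem ClearsBernoulli.coeff_coneTodd [IsDomain A] {N : ℕ} {K : ℚ} {κ : ℤ}
    (h : ClearsBernoulli N K κ) (hN : Even N) (hN0 : 0 < N) (S : Subring A) (q : ℕ) (hq : 0 < q) :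
    ∀ (p s t : ℤ), q * t + p * s = 1 → ∀ w ∈ S, ∀ v ∈ S,
      (∀ m n : ℤ, (m : A) * w + (n : A) * v = 0 → m = 0 ∧ n = 0) →
      ∃ P ∈ S, algebraMap ℚ A K * coeff N (coneTodd q p w v) =
        κ * w ^ (N - 1) * (q * w - p * v) + κ * ((s : A) * w + t * v) ^ (N - 1) * v +
          (q * w - p * v) * v * P := by
  induction q using Nat.strong_induction_on with
  | _ q ih =>
  intro p s t hst w hw v hv hind
  have hpN : ∀ x : A, x ^ N = x ^ (N - 1) * x := fun x => by
    rw [← pow_succ, Nat.sub_add_cancel hN0]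
  by_cases hq1 : q = 1
  · subst hq1
    have ht : t = 1 - p * s := by push_cast at hst; linarith
    have hv1 : w - (p : A) * v ∈ S := sub_mem hw (mul_mem (intCast_mem S p) hv)
    have hv' : (s : A) * w + t * v ∈ S :=
      add_mem (mul_mem (intCast_mem S s) hw) (mul_mem (intCast_mem S t) hv)
    obtain ⟨Q, hQ, hQe⟩ := h.coeff_toddOf_mul_toddOf hN0 S hv1 hv
    obtain ⟨P1, hP1, h1⟩ := S.exists_pow_sub_pow_eq hw hv1 (N - 1)
    obtain ⟨P2, hP2, h2⟩ := S.exists_pow_sub_pow_eq hv' hv (N - 1)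
    refine ⟨Q - κ * p * P1 - κ * s * P2, ?_, ?_⟩
    · exact sub_mem (sub_mem hQ (mul_mem (mul_mem (intCast_mem S κ) (intCast_mem S p)) hP1))
        (mul_mem (mul_mem (intCast_mem S κ) (intCast_mem S s)) hP2)
    · rw [coneTodd_one, hQe, hpN, hpN]
      have ht' : (t : A) = 1 - p * s := by rw [ht]; push_cast; ring
      rw [ht'] at h2 ⊢
      push_cast
      linear_combination (-(κ : A) * (w - p * v)) * h1 - (κ : A) * v * h2
  -- the case `q > 1` reduces to `0 < p < q` by the change of basis `w ↦ w - k v`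
  have hqz : (0 : ℤ) < q := by exact_mod_cast hq
  obtain ⟨p₀, hp₀⟩ : ∃ p₀ : ℕ, (p₀ : ℤ) = p % q :=
    ⟨(p % q).toNat, Int.toNat_of_nonneg (Int.emod_nonneg _ hqz.ne')⟩
  set k := p / q with hk
  have hpk : p = p₀ + q * k := by rw [hp₀, hk, Int.emod_add_mul_ediv]
  have hp₀q : p₀ < q := by
    have := Int.emod_lt_of_pos p hqz
    omega
  have hp₀pos : 0 < p₀ := by
    rcases Nat.eq_zero_or_pos p₀ with h0 | h0
    · exfalso
      rw [h0] at hpk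
      have hu : (q : ℤ) ∣ 1 := ⟨t + k * s, by rw [← hst, hpk]; push_cast; ring⟩
      have := Int.eq_one_of_dvd_one hqz.le hu
      omega
    · exact h0
  set w₀ : A := w - (k : A) * v with hw₀
  have hw₀S : w₀ ∈ S := sub_mem hw (mul_mem (intCast_mem S k) hv)
  have hind₀ : ∀ m n : ℤ, (m : A) * w₀ + (n : A) * v = 0 → m = 0 ∧ n = 0 := by
    intro m n hmn
    have := hind m (n - m * k) (by rw [← hmn, hw₀]; push_cast; ring)
    obtain ⟨rfl, h2⟩ := this
    exact ⟨rfl, by simpa using h2⟩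
  -- The ray through `w₀` cuts off a cone of multiplicity `p₀ < q` with generators `v₁` and `w₀`;
  -- here `-v` completes `w₀`, and the vector completing `v₁` is unchanged.
  obtain ⟨P', hP', hP'e⟩ := ih p₀ hp₀q hp₀pos (-(q : ℤ)) (-(t + k * s)) s
    (by rw [← hst, hpk]; ring) (-v) (neg_mem hv) w₀ hw₀S (by
      intro m n hmn
      have := hind₀ n (-m) (by rw [← hmn]; push_cast; ring)
      exact ⟨by simpa using this.2, this.1⟩)
  obtain ⟨Q, hQ, hQe⟩ := h.coeff_toddOf_mul_toddOf hN0 S hv hw₀S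
  obtain ⟨b, hb⟩ := h.pred
  obtain ⟨P1, hP1, h1⟩ := S.exists_pow_sub_pow_eq hw₀S hw (N - 1)
  refine ⟨P' + Q - b * w₀ ^ (N - 2) - κ * k * P1, ?_, ?_⟩
  · exact sub_mem (sub_mem (add_mem hP' hQ) (mul_mem (intCast_mem S b) (pow_mem hw₀S _)))
      (mul_mem (mul_mem (intCast_mem S κ) (intCast_mem S k)) hP1)
  have hw₀0 : w₀ ≠ 0 := by
    intro h0
    have := (hind₀ 1 0 (by rw [h0]; simp)).1
    omega
  apply mul_left_cancel₀ hw₀0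
  have hrec := congrArg (coeff N) (coneTodd_reciprocity hp₀pos hq w₀ v)
  obtain ⟨M, rfl⟩ : ∃ M, N = M + 2 := by
    obtain ⟨m, rfl⟩ := hN
    exact ⟨m + m - 2, by omega⟩
  have hcoeff : coeff (M + 2) ((toddOf v - C v * X) * toddOf w₀) =
      coeff (M + 2) (toddOf v * toddOf w₀) - v * coeff (M + 1) (toddOf w₀) := by
    rw [sub_mul, map_sub, mul_assoc, coeff_C_mul, coeff_succ_X_mul]
  rw [map_add, coeff_C_mul, coeff_C_mul, coeff_C_mul, hcoeff, coeff_toddOf] at hrec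
  have hb' : algebraMap ℚ A K * algebraMap ℚ A (bernoulli' (M + 1) / (M + 1).factorial) =
      (b : A) := by
    rw [← map_mul, ← map_intCast (algebraMap ℚ A) b, ← hb]
    rfl
  -- `N - 1` is odd, so the terms `v₁ v ^ N`, not divisible by `w₀`, of the two pieces cancel
  have hodd : (-v) ^ (M + 1) = -v ^ (M + 1) := by
    apply Odd.neg_pow
    obtain ⟨m, hm⟩ := hN
    exact ⟨m - 1, by omega⟩
  rw [hpk, coneTodd_shift hq, ← hw₀]
  have hs : ((-(t + k * s) : ℤ) : A) * -v + (s : A) * w₀ = (s : A) * w + t * v := by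
    rw [hw₀]
    push_cast
    ring
  simp only [show M + 2 - 1 = M + 1 from rfl, show M + 2 - 2 = M from rfl] at *
  rw [hs, hodd] at hP'e
  have hww : w = w₀ + k * v := by rw [hw₀]; ring
  push_cast at hP'e hrec ⊢
  generalize (s : A) * w + t * v = v' at *
  have h1' : w₀ ^ (M + 1) - w ^ (M + 1) = -(k * v) * P1 := by
    rw [h1, hww]; ring
  generalize w ^ (M + 1) = wM at *
  rw [hww]
  linear_combination (algebraMap ℚ A K) * hrec + v * hP'e + (q * w₀ - p₀ * v) * hQe
    - (q * w₀ - p₀ * v) * v * w₀ ^ (M + 1) * hb' + (κ : A) * w₀ * (q * w₀ - p₀ * v) * h1'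

end Integrality

/-! ### The Todd series of a cone, graded by degree -/

/-- The series `x T / (1 - c * exp (-x T))`, where `x` is the `i`-th of two polynomial
variables. -/
def gradedToddFactor (i : Fin 2) (c : ℂ) : (MvPolynomial (Fin 2) ℂ)⟦X⟧ :=
  rescale (MvPolynomial.X i) (PowerSeries.map MvPolynomial.C (toddFactor c))

/-- The Todd series of a cone, as a power series in one variable `T` whose `N`-th coefficient is
the homogeneous part of degree `N`, a polynomial. -/
def LatticeCone.gradedTodd (σ : LatticeCone) : (MvPolynomial (Fin 2) ℂ)⟦X⟧ :=
  ∑ γ : σ.Gamma, gradedToddFactor 0 (σ.char 0 γ) * gradedToddFactor 1 (σ.char 1 γ)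

theorem coeff_coeff_gradedToddFactor_mul (c d : ℂ) (N : ℕ) (e : Fin 2 →₀ ℕ) :
    MvPolynomial.coeff e (coeff N (gradedToddFactor 0 c * gradedToddFactor 1 d)) =
      if e.degree = N then coeff (e 0) (toddFactor c) * coeff (e 1) (toddFactor d) else 0 := by
  have hmon : ∀ k l : ℕ, coeff k (gradedToddFactor 0 c) * coeff l (gradedToddFactor 1 d) =
      MvPolynomial.monomial (Finsupp.single 0 k + Finsupp.single 1 l)
        (coeff k (toddFactor c) * coeff l (toddFactor d)) := by
    intro k l
    rw [gradedToddFactor, gradedToddFactor, coeff_rescale, coeff_rescale, coeff_map, coeff_map,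
      MvPolynomial.X_pow_eq_monomial, MvPolynomial.X_pow_eq_monomial, mul_comm,
      mul_comm _ (MvPolynomial.C _), MvPolynomial.C_mul_monomial, mul_comm _ (MvPolynomial.C _),
      MvPolynomial.C_mul_monomial, MvPolynomial.monomial_mul]
    rw [add_comm]
    congr 1
    ring
  have hdeg : e.degree = e 0 + e 1 := by
    rw [Finsupp.degree_eq_sum, Fin.sum_univ_two]
  have heq : ∀ k l : ℕ, Finsupp.single (0 : Fin 2) k + Finsupp.single 1 l = e ↔
      k = e 0 ∧ l = e 1 := by
    intro k l
    rw [Finsupp.ext_iff, Fin.forall_fin_two]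
    simp
  rw [coeff_mul, MvPolynomial.coeff_sum]
  simp only [hmon, MvPolynomial.coeff_monomial, heq]
  split_ifs with h
  · rw [sum_eq_single (e 0, e 1)]
    · simp
    · rintro ⟨k, l⟩ _ hne
      rw [if_neg]
      rintro ⟨rfl, rfl⟩
      exact hne rfl
    · intro hmem
      exact absurd (HasAntidiagonal.mem_antidiagonal.2 (hdeg ▸ h)) hmem
  · refine sum_eq_zero fun x hx => if_neg ?_
    rintro ⟨h0, h1⟩
    rw [HasAntidiagonal.mem_antidiagonal, h0, h1, ← hdeg] at hx
    exact h hx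

theorem coeff_subst_X_zero_mul_subst_X_one {R : Type*} [CommRing R] (f g : R⟦X⟧)
    (e : Fin 2 →₀ ℕ) :
    MvPowerSeries.coeff e (f.subst (MvPowerSeries.X (0 : Fin 2) : MvPowerSeries (Fin 2) R) *
      g.subst (MvPowerSeries.X (1 : Fin 2) : MvPowerSeries (Fin 2) R)) =
      coeff (e 0) f * coeff (e 1) g := by
  have he : Finsupp.single 0 (e 0) + Finsupp.single 1 (e 1) = e := by
    ext i
    fin_cases i <;> simp
  rw [MvPowerSeries.coeff_mul,
    Finset.sum_eq_single (Finsupp.single 0 (e 0), Finsupp.single 1 (e 1))]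
  · rw [coeff_subst_single, coeff_subst_single, if_pos (by simp), if_pos (by simp)]
    simp
  · rintro ⟨b, c⟩ hb hne
    rw [coeff_subst_single, coeff_subst_single]
    split_ifs with h0 h1
    · refine absurd ?_ hne
      have hbc := HasAntidiagonal.mem_antidiagonal.1 hb
      dsimp only at hbc h0 h1
      rw [← hbc, Prod.mk.injEq]
      constructor
      · rw [Finsupp.add_apply, h1, Finsupp.single_eq_of_ne (by decide), add_zero]
        exact h0
      · rw [Finsupp.add_apply, h0, Finsupp.single_eq_of_ne (by decide), zero_add]
        exact h1
    all_goals simp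
  · intro h
    exact absurd (HasAntidiagonal.mem_antidiagonal.2 he) h

theorem LatticeCone.homogeneousComponent_todd (σ : LatticeCone) (N : ℕ) :
    MvPowerSeries.homogeneousComponent N σ.todd =
      ((coeff N σ.gradedTodd : MvPolynomial (Fin 2) ℂ) : MvPowerSeries (Fin 2) ℂ) := by
  ext e
  rw [MvPowerSeries.coeff_homogeneousComponent, MvPolynomial.coeff_coe, gradedTodd, todd,
    map_sum, map_sum, MvPolynomial.coeff_sum]
  simp only [coeff_coeff_gradedToddFactor_mul]
  split_ifs with h
  · exact sum_congr rfl fun γ _ => coeff_subst_X_zero_mul_subst_X_one _ _ _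
  · simp

theorem gradedToddFactor_mul (i : Fin 2) (c : ℂ) :
    gradedToddFactor i c * (1 - C (MvPolynomial.C c) * expNeg (MvPolynomial.X i)) =
      C (MvPolynomial.X i) * X := by
  have h := congrArg (fun f => rescale (MvPolynomial.X i : MvPolynomial (Fin 2) ℂ)
    (PowerSeries.map MvPolynomial.C f)) (toddFactor_mul_toddDenom c)
  simp only [map_mul, map_X, rescale_X] at h
  rw [← h, gradedToddFactor]
  congr 1
  have hexp : PowerSeries.map (MvPolynomial.C : ℂ →+* MvPolynomial (Fin 2) ℂ)
      (evalNegHom (PowerSeries.exp ℂ)) = rescale (-1) (PowerSeries.exp _) := by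
    rw [evalNegHom, ← rescale_map, map_exp, map_neg, map_one]
  rw [toddDenom, map_sub, map_sub, map_one, map_one, map_mul, map_mul, map_C, hexp,
    rescale_rescale, neg_one_mul, expNeg]
  congr 2
  ext n
  rw [coeff_rescale, coeff_C]
  split_ifs with hn <;> simp [hn]

/-- For a root of unity `c` of order dividing `q`, multiplication by `1 - exp (-q x T)` turns the
denominator of a Todd factor into a finite geometric sum. -/
theorem gradedToddFactor_mul_one_sub_expNeg (i : Fin 2) {c : ℂ} {q : ℕ} (hc : c ^ q = 1) :
    gradedToddFactor i c * (1 - expNeg ((q : MvPolynomial (Fin 2) ℂ) * MvPolynomial.X i)) =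
      C (MvPolynomial.X i) * X *
        ∑ m ∈ range q, (C (MvPolynomial.C c) * expNeg (MvPolynomial.X i)) ^ m := by
  rw [← gradedToddFactor_mul i c, mul_assoc, mul_neg_geom_sum, mul_pow, ← map_pow, ← map_pow, hc,
    map_one, map_one, one_mul, expNeg_natCast_mul]

/-! ### The cone spanned by `(1, 0)` and `(p, q)` -/

section StandardCone

variable {p q : ℕ} (hq : 0 < q) (hpq : Nat.Coprime p q)

theorem standardCone_coord (g : Fin 2 → ℤ) :
    (standardCone p q hq hpq).coord g = ![(g 0 : ℚ) - p * (g 1 : ℚ) / q, (g 1 : ℚ) / q] := by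
  have hq' : (q : ℚ) ≠ 0 := by exact_mod_cast hq.ne'
  rw [LatticeCone.coord_eq_iff, Fin.forall_fin_two]
  simp only [standardCone, Matrix.cons_val_zero, Matrix.cons_val_one]
  push_cast
  constructor
  · field_simp
    ring
  · field_simp
    ring

/-- The vectors `(0, j)` with `0 ≤ j < q` represent the classes modulo the two generators. -/
theorem standardCone_bijective :
    Function.Bijective (fun j : Fin q =>
      (QuotientAddGroup.mk ![0, ((j : ℕ) : ℤ)] : (standardCone p q hq hpq).Gamma)) := by
  have hv0 : (standardCone p q hq hpq).v 0 = ![1, 0] := rfl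
  have hv1 : (standardCone p q hq hpq).v 1 = ![(p : ℤ), (q : ℤ)] := rfl
  constructor
  · intro j k hjk
    have hmem := QuotientAddGroup.eq.1 hjk
    have hdvd : ∀ g ∈ (standardCone p q hq hpq).sublattice, (q : ℤ) ∣ g 1 := by
      intro g hg
      induction hg using AddSubgroup.closure_induction with
      | mem x hx =>
        obtain ⟨i, rfl⟩ := hx
        fin_cases i
        · simp [hv0]
        · simp [hv1]
      | zero => simp
      | add x y _ _ hx hy => exact dvd_add hx hy
      | neg x _ hx => exact (dvd_neg (α := ℤ)).2 hx
    have h := hdvd _ hmem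
    simp only [Pi.add_apply, Pi.neg_apply, Matrix.cons_val_one, Matrix.cons_val_zero] at h
    rw [neg_add_eq_sub] at h
    have h2 : ((j : ℕ) : ℤ) % q = ((k : ℕ) : ℤ) % q := Int.modEq_iff_dvd.2 h
    rw [Int.emod_eq_of_lt (by omega) (by exact_mod_cast j.2),
      Int.emod_eq_of_lt (by omega) (by exact_mod_cast k.2)] at h2
    exact Fin.ext (by exact_mod_cast h2)
  · intro γ
    obtain ⟨g, rfl⟩ := QuotientAddGroup.mk_surjective γ
    have hqz : (0 : ℤ) < q := by exact_mod_cast hq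
    have hnn := Int.emod_nonneg (g 1) hqz.ne'
    have hlt := Int.emod_lt_of_pos (g 1) hqz
    refine ⟨⟨(g 1 % q).toNat, by omega⟩, ?_⟩
    rw [QuotientAddGroup.eq]
    have h : -![0, (((g 1 % q).toNat : ℕ) : ℤ)] + g =
        (g 0 - p * (g 1 / q)) • (standardCone p q hq hpq).v 0 +
          (g 1 / q) • (standardCone p q hq hpq).v 1 := by
      rw [hv0, hv1, Int.toNat_of_nonneg hnn]
      ext r
      have hdm := Int.emod_add_mul_ediv (g 1) q
      fin_cases r
      · simp
        ring
      · simp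
        linarith
    change -![0, (((g 1 % q).toNat : ℕ) : ℤ)] + g ∈ (standardCone p q hq hpq).sublattice
    rw [h]
    exact add_mem (zsmul_mem (AddSubgroup.subset_closure (Set.mem_range_self 0)) _)
      (zsmul_mem (AddSubgroup.subset_closure (Set.mem_range_self 1)) _)

theorem standardCone_char (j : ℕ) :
    (standardCone p q hq hpq).char 0 (QuotientAddGroup.mk ![0, (j : ℤ)]) =
        ((Complex.exp (2 * Real.pi * Complex.I / q))⁻¹ ^ p) ^ j ∧
      (standardCone p q hq hpq).char 1 (QuotientAddGroup.mk ![0, (j : ℤ)]) =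
        Complex.exp (2 * Real.pi * Complex.I / q) ^ j := by
  rw [LatticeCone.char_mk, LatticeCone.char_mk, LatticeCone.latticeChar, LatticeCone.latticeChar,
    standardCone_coord, ← Complex.exp_neg, ← Complex.exp_nat_mul, ← Complex.exp_nat_mul,
    ← Complex.exp_nat_mul]
  constructor
  · congr 1
    simp
    ring
  · congr 1
    simp
    ring

end StandardCone

/-- Orthogonality of characters of the cyclic group of order `q`. -/
theorem IsPrimitiveRoot.sum_inv_pow_mul_pow {ζ : ℂ} {p q : ℕ} (hζ : IsPrimitiveRoot ζ q)
    (hq : 0 < q) (i m : ℕ) (hm : m < q) :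
    ∑ j ∈ range q, ((ζ⁻¹ ^ p) ^ j) ^ i * (ζ ^ j) ^ m = if m = p * i % q then (q : ℂ) else 0 := by
  have hζ0 : ζ ≠ 0 := hζ.ne_zero hq.ne'
  have h : ∀ j ∈ range q, ((ζ⁻¹ ^ p) ^ j) ^ i * (ζ ^ j) ^ m = (ζ⁻¹ ^ (p * i) * ζ ^ m) ^ j :=
    fun j _ => by ring
  rw [sum_congr rfl h]
  have hmod : ζ ^ (p * i) = ζ ^ (p * i % q) := by
    conv_lhs => rw [← Nat.mod_add_div (p * i) q, pow_add, pow_mul, hζ.pow_eq_one, one_pow, mul_one]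
  split_ifs with hmi
  · rw [hmi, ← hmod, ← mul_pow, inv_mul_cancel₀ hζ0]
    simp
  · set y := ζ⁻¹ ^ (p * i) * ζ ^ m with hy
    have hy1 : y ≠ 1 := by
      intro h1
      apply hmi
      apply hζ.pow_inj hm (Nat.mod_lt _ hq)
      rw [← hmod, ← mul_one (ζ ^ (p * i)), ← h1, hy, ← mul_assoc, ← mul_pow, mul_inv_cancel₀ hζ0,
        one_pow, one_mul]
    have hyq : y ^ q = 1 := by
      have h1 : ∀ n : ℕ, (ζ ^ n) ^ q = 1 := fun n => by
        rw [← pow_mul, mul_comm, pow_mul, hζ.pow_eq_one, one_pow]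
      rw [hy, mul_pow, h1, inv_pow, inv_pow, h1, inv_one, one_mul]
    have := mul_neg_geom_sum y q
    rw [hyq, sub_self] at this
    exact (mul_eq_zero.1 this).resolve_left (sub_ne_zero.2 hy1.symm)

section StandardConeTodd

variable {p q : ℕ} (hq : 0 < q) (hpq : Nat.Coprime p q)

theorem standardCone_gradedTodd_mul :
    (standardCone p q hq hpq).gradedTodd *
        ((1 - expNeg ((q : MvPolynomial (Fin 2) ℂ) * MvPolynomial.X 0)) *
          (1 - expNeg ((q : MvPolynomial (Fin 2) ℂ) * MvPolynomial.X 1))) =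
      C (MvPolynomial.X 0) * X * (C (MvPolynomial.X 1) * X) * (C (q : MvPolynomial (Fin 2) ℂ) *
        ∑ i ∈ range q, expNeg (MvPolynomial.X 0) ^ i *
          expNeg (MvPolynomial.X 1) ^ (p * i % q)) := by
  set ζ := Complex.exp (2 * Real.pi * Complex.I / q) with hζdef
  have hζ : IsPrimitiveRoot ζ q := Complex.isPrimitiveRoot_exp q hq.ne'
  set E0 : (MvPolynomial (Fin 2) ℂ)⟦X⟧ := expNeg (MvPolynomial.X 0)
  set E1 : (MvPolynomial (Fin 2) ℂ)⟦X⟧ := expNeg (MvPolynomial.X 1)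
  have hsum : (standardCone p q hq hpq).gradedTodd =
      ∑ j ∈ range q, gradedToddFactor 0 ((ζ⁻¹ ^ p) ^ j) * gradedToddFactor 1 (ζ ^ j) := by
    rw [LatticeCone.gradedTodd, ← Fin.sum_univ_eq_sum_range
      (fun j => gradedToddFactor 0 ((ζ⁻¹ ^ p) ^ j) * gradedToddFactor 1 (ζ ^ j))]
    symm
    refine Fintype.sum_bijective _ (standardCone_bijective hq hpq) _ _ fun j => ?_
    rw [(standardCone_char hq hpq j).1, (standardCone_char hq hpq j).2]
  have hζj : ∀ j : ℕ, (ζ ^ j) ^ q = 1 := fun j => by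
    rw [← pow_mul, mul_comm, pow_mul, hζ.pow_eq_one, one_pow]
  have hζj' : ∀ j : ℕ, ((ζ⁻¹ ^ p) ^ j) ^ q = 1 := fun j => by
    rw [inv_pow, inv_pow, inv_pow, ← pow_mul ζ, hζj, inv_one]
  have hterm : ∀ j ∈ range q, gradedToddFactor 0 ((ζ⁻¹ ^ p) ^ j) * gradedToddFactor 1 (ζ ^ j) *
        ((1 - expNeg ((q : MvPolynomial (Fin 2) ℂ) * MvPolynomial.X 0)) *
          (1 - expNeg ((q : MvPolynomial (Fin 2) ℂ) * MvPolynomial.X 1))) =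
      C (MvPolynomial.X 0) * X * (C (MvPolynomial.X 1) * X) *
        ∑ i ∈ range q, ∑ m ∈ range q,
          C (MvPolynomial.C (((ζ⁻¹ ^ p) ^ j) ^ i * (ζ ^ j) ^ m)) * (E0 ^ i * E1 ^ m) := by
    intro j _
    have hprod : ∑ i ∈ range q, ∑ m ∈ range q,
          C (MvPolynomial.C (((ζ⁻¹ ^ p) ^ j) ^ i * (ζ ^ j) ^ m)) * (E0 ^ i * E1 ^ m) =
        (∑ i ∈ range q, (C (MvPolynomial.C ((ζ⁻¹ ^ p) ^ j)) * E0) ^ i) *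
          ∑ m ∈ range q, (C (MvPolynomial.C (ζ ^ j)) * E1) ^ m := by
      rw [sum_mul_sum]
      refine sum_congr rfl fun i _ => sum_congr rfl fun m _ => ?_
      rw [map_mul, map_mul, map_pow _ _ i, map_pow _ _ i, map_pow _ _ m, map_pow _ _ m, mul_pow,
        mul_pow, mul_mul_mul_comm]
    have h0 := gradedToddFactor_mul_one_sub_expNeg 0 (hζj' j)
    have h1 := gradedToddFactor_mul_one_sub_expNeg 1 (hζj j)
    rw [hprod, mul_mul_mul_comm, h0, h1, mul_mul_mul_comm]
  rw [hsum, sum_mul, sum_congr rfl hterm, ← mul_sum]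
  congr 1
  rw [sum_comm, mul_sum]
  refine sum_congr rfl fun i _ => ?_
  rw [sum_comm]
  have hin : ∀ m ∈ range q, ∑ j ∈ range q,
      C (MvPolynomial.C (((ζ⁻¹ ^ p) ^ j) ^ i * (ζ ^ j) ^ m)) * (E0 ^ i * E1 ^ m) =
      if m = p * i % q then C (q : MvPolynomial (Fin 2) ℂ) * (E0 ^ i * E1 ^ m) else 0 := by
    intro m hm
    rw [← sum_mul, ← map_sum, ← map_sum, hζ.sum_inv_pow_mul_pow hq i m (mem_range.1 hm)]
    split_ifs with h
    · rw [map_natCast]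
    · simp
  rw [sum_congr rfl hin, sum_ite_eq', if_pos (mem_range.2 (Nat.mod_lt _ hq))]

/-- The Todd series defined by characters is that of the cone spanned by `q x` and `q y` in the
lattice of linear forms with basis `x + p y`, `q y`. -/
theorem coneTodd_eq_gradedTodd :
    coneTodd q p (MvPolynomial.X 0 + (p : MvPolynomial (Fin 2) ℂ) * MvPolynomial.X 1)
        ((q : MvPolynomial (Fin 2) ℂ) * MvPolynomial.X 1) =
      C (q : MvPolynomial (Fin 2) ℂ) * (standardCone p q hq hpq).gradedTodd := by
  have hq0 : (q : MvPolynomial (Fin 2) ℂ) ≠ 0 := by exact_mod_cast hq.ne'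
  have hne : ∀ i : Fin 2, (1 : (MvPolynomial (Fin 2) ℂ)⟦X⟧) -
      expNeg ((q : MvPolynomial (Fin 2) ℂ) * MvPolynomial.X i) ≠ 0 := by
    intro i h0
    have h := toddOf_mul_one_sub_expNeg ((q : MvPolynomial (Fin 2) ℂ) * MvPolynomial.X i)
    rw [h0, mul_zero] at h
    refine mul_ne_zero ?_ PowerSeries.X_ne_zero h.symm
    rw [Ne, map_eq_zero_iff _ (PowerSeries.C_injective)]
    exact mul_ne_zero hq0 (MvPolynomial.X_ne_zero i)
  apply mul_right_cancel₀ (mul_ne_zero (hne 0) (hne 1))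
  have hpar : parallelogramSum q (p : ℤ)
      (MvPolynomial.X 0 + (p : MvPolynomial (Fin 2) ℂ) * MvPolynomial.X 1)
        ((q : MvPolynomial (Fin 2) ℂ) * MvPolynomial.X 1) =
      ∑ i ∈ range q, expNeg (MvPolynomial.X 0) ^ i *
          expNeg (MvPolynomial.X 1) ^ (p * i % q) := by
    refine sum_congr rfl fun i _ => ?_
    rw [← expNeg_natCast_mul, ← expNeg_natCast_mul, ← expNeg_add]
    congr 1
    have h : ((p * i % q : ℕ) : MvPolynomial (Fin 2) ℂ) = i * p - (i * p / q : ℕ) * q := by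
      have := Nat.mod_add_div (i * p) q
      rw [mul_comm p i, eq_sub_iff_add_eq]
      rw [mul_comm q] at this
      exact_mod_cast this
    rw [h]
    have h2 : ((((i : ℤ) * (p : ℤ)) / (q : ℤ) : ℤ) : MvPolynomial (Fin 2) ℂ) =
      ((i * p / q : ℕ) : MvPolynomial (Fin 2) ℂ) := by norm_cast
    rw [h2]
    ring
  have hv : (q : MvPolynomial (Fin 2) ℂ) *
      (MvPolynomial.X 0 + (p : MvPolynomial (Fin 2) ℂ) * MvPolynomial.X 1) -
        ((p : ℤ) : MvPolynomial (Fin 2) ℂ) * ((q : MvPolynomial (Fin 2) ℂ) * MvPolynomial.X 1) =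
      (q : MvPolynomial (Fin 2) ℂ) * MvPolynomial.X 0 := by
    rw [Int.cast_natCast]
    ring
  have h0 := toddOf_mul_one_sub_expNeg ((q : MvPolynomial (Fin 2) ℂ) * MvPolynomial.X 0)
  have h1 := toddOf_mul_one_sub_expNeg ((q : MvPolynomial (Fin 2) ℂ) * MvPolynomial.X 1)
  rw [mul_assoc (C _), standardCone_gradedTodd_mul, coneTodd, hv, hpar]
  rw [map_mul] at h0 h1
  set S := ∑ i ∈ range q, expNeg (MvPolynomial.X 0 : MvPolynomial (Fin 2) ℂ) ^ i *
          expNeg (MvPolynomial.X 1) ^ (p * i % q)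
  set e1 := (1 : (MvPolynomial (Fin 2) ℂ)⟦X⟧) -
      expNeg ((q : MvPolynomial (Fin 2) ℂ) * MvPolynomial.X 1)
  linear_combination (S * toddOf ((q : MvPolynomial (Fin 2) ℂ) * MvPolynomial.X 1) * e1) * h0
    + S * (C (q : MvPolynomial (Fin 2) ℂ) * C (MvPolynomial.X 0) * X) * h1

end StandardConeTodd

/-! ### Convergents of finite continued fractions -/

/-- Numerator and denominator of a finite continued fraction, computed by continuants; the empty
continued fraction is `1 / 0`. -/
def continuants : List ℕ → ℕ × ℕ
  | [] => (1, 0)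
  | a :: l => (a * (continuants l).1 + (continuants l).2, (continuants l).1)

theorem coprime_continuants (l : List ℕ) : (continuants l).1.Coprime (continuants l).2 := by
  induction l with
  | nil => simp [continuants]
  | cons a l ih =>
    rw [continuants, Nat.coprime_mul_right_add_left]
    exact ih.symm

theorem continuants_fst_pos {l : List ℕ} (hl : ∀ c ∈ l, 1 ≤ c) : 0 < (continuants l).1 := by
  induction l with
  | nil => simp [continuants]
  | cons a l ih =>
    rw [List.forall_mem_cons] at hl
    exact Nat.add_pos_left (Nat.mul_pos hl.1 (ih hl.2)) _

theorem cfValue_eq_continuants {l : List ℕ} (hl : ∀ c ∈ l, 1 ≤ c) (hne : l ≠ []) :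
    cfValue l = (continuants l).1 / (continuants l).2 := by
  induction l with
  | nil => exact absurd rfl hne
  | cons a l ih =>
    rw [List.forall_mem_cons] at hl
    cases l with
    | nil => simp [cfValue, continuants]
    | cons b l =>
      have hpos : ((continuants (b :: l)).1 : ℚ) ≠ 0 := by
        exact_mod_cast (continuants_fst_pos hl.2).ne'
      have hcons : continuants (a :: b :: l) =
          (a * (continuants (b :: l)).1 + (continuants (b :: l)).2, (continuants (b :: l)).1) := rfl
      rw [cfValue, ih hl.2 (List.cons_ne_nil b l), hcons, one_div_div]
      push_cast
      rw [add_div, mul_div_cancel_right₀ _ hpos]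

theorem num_and_den_of_eq_div {x : ℚ} {m n : ℕ} (hn : 0 < n) (hc : m.Coprime n)
    (hx : x = (m : ℚ) / n) : x.num = m ∧ x.den = n := by
  have h1 : x = ((m : ℤ) : ℚ) / ((n : ℤ) : ℚ) := by rw [hx]; push_cast; rfl
  have hn' : (0 : ℤ) < n := by exact_mod_cast hn
  rw [h1]
  exact ⟨Rat.num_div_eq_of_coprime hn' (by simpa using hc),
    by exact_mod_cast Rat.den_div_eq_of_coprime hn' (by simpa using hc)⟩

theorem continuants_snd_pos {l : List ℕ} (hl : ∀ c ∈ l, 1 ≤ c) (hne : l ≠ []) :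
    0 < (continuants l).2 := by
  cases l with
  | nil => exact absurd rfl hne
  | cons a l => exact continuants_fst_pos (List.forall_mem_cons.1 hl).2

theorem cfNum_eq_continuants {l : List ℕ} (hl : ∀ c ∈ l, 1 ≤ c) (hne : l ≠ []) (i : ℕ) :
    cfNum l i = (continuants (l.take i)).1 := by
  have hl' : ∀ c ∈ l.take i, 1 ≤ c := fun c hc => hl c (List.mem_of_mem_take hc)
  rw [cfNum]
  split_ifs with hi
  · simp [hi, continuants]
  · have hne' : l.take i ≠ [] := by simp [hi, hne]
    exact (num_and_den_of_eq_div (continuants_snd_pos hl' hne') (coprime_continuants _)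
      (cfValue_eq_continuants hl' hne')).1

theorem continuants_det {l : List ℕ} (hne : l ≠ []) :
    ((continuants l).1 : ℤ) * (continuants l.dropLast).2 -
      (continuants l).2 * (continuants l.dropLast).1 = (-1) ^ l.length := by
  induction l with
  | nil => exact absurd rfl hne
  | cons a l ih =>
    cases l with
    | nil => simp [continuants]
    | cons b l =>
      have h := ih (List.cons_ne_nil b l)
      rw [List.dropLast_cons_of_ne_nil (List.cons_ne_nil b l), List.length_cons, pow_succ, ← h]
      generalize b :: l = l'
      simp only [continuants]
      push_cast
      ring

/-- Up to sign, the numerator of the last proper convergent of `q / p` inverts `p` modulo `q`. -/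
theorem exists_mul_add_mul_cfNum_eq_one {p q : ℕ} (hp : 0 < p) (hcop : Nat.Coprime p q)
    {a : List ℕ} (ha : ∀ c ∈ a, 1 ≤ c) (hne : a ≠ []) (hcf : cfValue a = (q : ℚ) / p) :
    ∃ t : ℤ, q * t + p * ((-1) ^ (a.length - 1) * cfNum a (a.length - 1)) = 1 := by
  obtain ⟨hn, hd⟩ := num_and_den_of_eq_div hp hcop.symm hcf
  obtain ⟨hn', hd'⟩ := num_and_den_of_eq_div (continuants_snd_pos ha hne) (coprime_continuants a)
    (cfValue_eq_continuants ha hne)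
  have h := continuants_det hne
  rw [← hn', ← hd', hn, hd] at h
  rw [cfNum_eq_continuants ha hne, ← List.dropLast_eq_take]
  obtain ⟨m, hm⟩ : ∃ m, a.length = m + 1 :=
    ⟨a.length - 1, by have := List.length_pos_iff.2 hne; omega⟩
  refine ⟨(-1) ^ a.length * (continuants a.dropLast).2, ?_⟩
  have hs : ((-1 : ℤ) ^ m) * (-1) ^ m = 1 := by rw [← mul_pow]; simp
  rw [hm] at h ⊢
  rw [Nat.add_sub_cancel]
  rw [pow_succ] at h ⊢
  linear_combination (-(-1) ^ m) * h + hs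

end

/-! ### The congruence for the Todd series -/

theorem mainTheorem7
    (p q : ℕ) (hp : 0 < p) (hpq : p < q) (hcop : Nat.Coprime p q)
    (a : List ℕ) (ha : ∀ c ∈ a, 1 ≤ c) (hcf : cfValue a = (q : ℚ) / (p : ℚ))
    (N : ℕ) (hN : 0 < N) (hNeven : Even N) :
    ∃ P : MvPolynomial (Fin 2) ℤ,
      ((N.factorial : ℂ) * (bernoulliDen N : ℂ) * (toddLcm N : ℂ)) •
          MvPowerSeries.homogeneousComponent N
            (standardCone p q (hp.trans hpq) hcop).todd
        - ((bernoulliNum N : ℂ) * (toddLcm N : ℂ)) •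
          ((MvPowerSeries.X 0 + (p : ℂ) • MvPowerSeries.X 1) ^ (N - 1) * MvPowerSeries.X 0)
        - ((bernoulliNum N : ℂ) * (toddLcm N : ℂ)) •
          ((((-1 : ℂ) ^ (a.length - 1) * (cfNum a (a.length - 1) : ℂ)) • MvPowerSeries.X 0
            + MvPowerSeries.X 1) ^ (N - 1) * MvPowerSeries.X 1)
      = (q : ℂ) • ((MvPolynomial.map (Int.castRingHom ℂ) P : MvPolynomial (Fin 2) ℂ) :
          MvPowerSeries (Fin 2) ℂ) := by
  have hq : 0 < q := hp.trans hpq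
  have hne : a ≠ [] := by
    rintro rfl
    have : (0 : ℚ) < (q : ℚ) / p := div_pos (by exact_mod_cast hq) (by exact_mod_cast hp)
    rw [← hcf, cfValue] at this
    exact lt_irrefl _ this
  obtain ⟨t, ht⟩ := exists_mul_add_mul_cfNum_eq_one hp hcop ha hne hcf
  have hsc : (-1 : ℂ) ^ (a.length - 1) * (cfNum a (a.length - 1) : ℂ) =
      (((-1) ^ (a.length - 1) * cfNum a (a.length - 1) : ℤ) : ℂ) := by
    push_cast
    rfl
  rw [hsc]
  generalize ((-1) ^ (a.length - 1) * cfNum a (a.length - 1) : ℤ) = s at ht ⊢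
  set S : Subring (MvPolynomial (Fin 2) ℂ) :=
    (MvPolynomial.map (σ := Fin 2) (Int.castRingHom ℂ)).range with hS
  have hX : ∀ i, (MvPolynomial.X i : MvPolynomial (Fin 2) ℂ) ∈ S := fun i =>
    ⟨MvPolynomial.X i, MvPolynomial.map_X _ _⟩
  have hw : (MvPolynomial.X 0 + (p : MvPolynomial (Fin 2) ℂ) * MvPolynomial.X 1) ∈ S :=
    add_mem (hX 0) (mul_mem (natCast_mem S p) (hX 1))
  have hv : ((q : MvPolynomial (Fin 2) ℂ) * MvPolynomial.X 1) ∈ S :=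
    mul_mem (natCast_mem S q) (hX 1)
  have hind : ∀ m n : ℤ, (m : MvPolynomial (Fin 2) ℂ) *
      (MvPolynomial.X 0 + (p : MvPolynomial (Fin 2) ℂ) * MvPolynomial.X 1) +
      (n : MvPolynomial (Fin 2) ℂ) * ((q : MvPolynomial (Fin 2) ℂ) * MvPolynomial.X 1) = 0 →
      m = 0 ∧ n = 0 := by
    intro m n h
    have h0 := congrArg (MvPolynomial.eval ![(1 : ℂ), 0]) h
    have h1 := congrArg (MvPolynomial.eval ![(0 : ℂ), 1]) h
    simp at h0 h1
    subst h0
    simpa [hq.ne'] using h1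
  obtain ⟨P, hP, hPe⟩ := (clearsBernoulli hNeven hN).coeff_coneTodd hNeven hN S q hq p s t ht
    _ hw _ hv hind
  obtain ⟨P', hP'⟩ := mul_mem (mul_mem (hX 0) (hX 1)) hP
  refine ⟨P', ?_⟩
  -- In the lattice with basis `x + p y`, `q y` the generators `v₁`, `v₂` of the cone are `q x`,
  -- `q y`, so `v₁ v₂ P` is `q` times `q x y P`; one factor `q` is cancelled below.
  have hq0 : (q : MvPolynomial (Fin 2) ℂ) ≠ 0 := by exact_mod_cast hq.ne'
  have htA : (q : MvPolynomial (Fin 2) ℂ) * (t : MvPolynomial (Fin 2) ℂ) +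
      (p : MvPolynomial (Fin 2) ℂ) * (s : MvPolynomial (Fin 2) ℂ) = 1 := by exact_mod_cast ht
  have hK : algebraMap ℚ (MvPolynomial (Fin 2) ℂ)
      ((N.factorial : ℚ) * bernoulliDen N * toddLcm N) =
      MvPolynomial.C ((N.factorial : ℂ) * (bernoulliDen N : ℂ) * (toddLcm N : ℂ)) := by
    simp
  have hκ : ((bernoulliNum N * toddLcm N : ℤ) : MvPolynomial (Fin 2) ℂ) =
      MvPolynomial.C ((bernoulliNum N : ℂ) * (toddLcm N : ℂ)) := by
    simp
  have hv' : (s : MvPolynomial (Fin 2) ℂ) *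
      (MvPolynomial.X 0 + (p : MvPolynomial (Fin 2) ℂ) * MvPolynomial.X 1) +
      (t : MvPolynomial (Fin 2) ℂ) * ((q : MvPolynomial (Fin 2) ℂ) * MvPolynomial.X 1) =
      (s : MvPolynomial (Fin 2) ℂ) * MvPolynomial.X 0 + MvPolynomial.X 1 := by
    linear_combination (MvPolynomial.X 1) * htA
  rw [coneTodd_eq_gradedTodd hq hcop, PowerSeries.coeff_C_mul, hK, hκ, hv', Int.cast_natCast] at hPe
  have hpoly : MvPolynomial.C ((N.factorial : ℂ) * (bernoulliDen N : ℂ) * (toddLcm N : ℂ)) *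
      PowerSeries.coeff N (standardCone p q hq hcop).gradedTodd
      - MvPolynomial.C ((bernoulliNum N : ℂ) * (toddLcm N : ℂ)) *
        ((MvPolynomial.X 0 + MvPolynomial.C (p : ℂ) * MvPolynomial.X 1) ^ (N - 1) *
          MvPolynomial.X 0)
      - MvPolynomial.C ((bernoulliNum N : ℂ) * (toddLcm N : ℂ)) *
        ((MvPolynomial.C (s : ℂ) * MvPolynomial.X 0 + MvPolynomial.X 1) ^ (N - 1) *
          MvPolynomial.X 1) =
      MvPolynomial.C (q : ℂ) * MvPolynomial.map (Int.castRingHom ℂ) P' := by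
    apply mul_left_cancel₀ hq0
    rw [hP', map_natCast, map_natCast, map_intCast]
    linear_combination hPe
  rw [sub_sub, sub_eq_iff_eq_add] at hpoly
  rw [LatticeCone.homogeneousComponent_todd, sub_sub, sub_eq_iff_eq_add]
  have h := congrArg (fun f : MvPolynomial (Fin 2) ℂ => (f : MvPowerSeries (Fin 2) ℂ)) hpoly
  simp only [MvPolynomial.coe_mul, MvPolynomial.coe_add,
    MvPolynomial.coe_pow, MvPolynomial.coe_X, MvPolynomial.coe_C,
    ← MvPowerSeries.smul_eq_C_mul] at h
  exact h
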